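/- Let $(\Omega,\mu)$ be a $\sigma$-finite, non-atomic measure space, and let $\mathcal M(\Omega,\mu)$ be the space of (classes of) real- or complex-valued $\mu$-measurable functions on $\Omega$. For $f\in\mathcal M(\Omega,\mu)$ let $f^*(t)=\inf\{\lambda\ge 0:\mu(\{|f|>\lambda\})\le t\}$, $t>0$, be its non-increasing rearrangement. Write $\|\cdot\|_{q,(a,b)}$ for the (quasi-)norm of $L_q(a,b)$ with respect to Lebesgue measure, with the convention $1/\infty=0$, $1/0=\infty$. A Lebesgue measurable function $b:(0,\infty)\to(0,\infty)$ is called slowly varying ($b\in SV$) if for each $\varepsilon>0$ the function $t^{\varepsilon}b(t)$ is equivalent (up to multiplicative constants) to a non-decreasing function and $t^{-\varepsilon}b(t)$ is equivalent to a non-increasing function on $(0,\infty)$. For two quasi-normed spaces $A_0,A_1\subset\mathcal M(\Omega,\mu)$ let $$K(t,f;A_0,A_1)=\inf\{\|f_0\|_{A_0}+t\|f_1\|_{A_1}: f=f_0+f_1,\ f_i\in A_i\},\qquad t>0,$$ and, for $0\le\theta\le1$, $0<s,r,q\le\infty$ and $a,b,c\in SV$, let $(A_0,A_1)^{\mathcal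 R,\mathcal R}_{\theta,s,c,r,b,q,a}$ be the set of all $f\in A_0+A_1$ for which $$\bigg\|t^{-\frac1s}c(t)\Big\|u^{-\frac1r}b(u)\big\|v^{-\theta-\frac1q}a(v)K(v,f;A_0,A_1)\big\|_{q,(u,\infty)}\Big\|_{r,(t,\infty)}\bigg\|_{s,(0,\infty)}<\infty,$$ with this expression as quasi-norm. For $0<p\le\infty$ let $L^{\mathcal R,\mathcal R}_{p,(s,c,r,b,q,a)}$ be the set of all $f\in\mathcal M(\Omega,\mu)$ for which $$\bigg\|t^{-\frac1s}c(t)\Big\|u^{-\frac1r}b(u)\big\|v^{\frac1p-\frac1q}a(v)f^*(v)\big\|_{q,(u,\infty)}\Big\|_{r,(t,\infty)}\bigg\|_{s,(0,\infty)}<\infty,$$ with this expression as quasi-norm. For $0<\varkappa<\infty$ let $L_{\varkappa,\infty}$ be the space of all $f\in\mathcal M(\Omega,\mu)$ with $\|t^{1/\varkappa}f^*(t)\|_{\infty,(0,\infty)}<\infty$, and let $L_\varkappa$ and $L_\infty$ be the Lebesgue spaces on $(\Omega,\mu)$. **Theorem.** Let $0<\theta\le 1$, $0<\varkappa<\infty$,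 $p=\frac{\varkappa}{1-\theta}$ (so $p=\infty$ if $\theta=1$), $0<q,s,r\le\infty$ and $a,b,c\in SV$. Put $\dddot a(u)=a(u^{1/\varkappa})$, $\dddot b(u)=b(u^{1/\varkappa})$, $\dddot c(u)=c(u^{1/\varkappa})$, $u>0$. Then $$(L_\varkappa,L_\infty)^{\mathcal R,\mathcal R}_{\theta,s,c,r,b,q,a}=(L_{\varkappa,\infty},L_\infty)^{\mathcal R,\mathcal R}_{\theta,s,c,r,b,q,a}=L^{\mathcal R,\mathcal R}_{p,(s,\dddot c,r,\dddot b,q,\dddot a)},$$ that is, the three spaces consist of the same functions and their quasi-norms are pairwise equivalent. -/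

import Mathlib

open MeasureTheory Set
open scoped ENNReal NNReal

/-- A linear space of vectors of the ambient module `X`, given as a set together with its
(quasi-)norm (the values of `qnorm` outside `carrier` are irrelevant). Only concrete instances,
built below, are used. -/
structure QNSpace (X : Type*) where
  carrier : Set X
  qnorm : X → ℝ≥0∞

namespace QNSpace

variable {X : Type*}

/-- The space of all `x` with `N x < ∞`, quasi-normed by `N`. -/
def ofQNorm (N : X → ℝ≥0∞) : QNSpace X where
  carrier := {x | N x < ∞}
  qnorm := N

/-- `A ⊂ B`: inclusion of sets with a bounded inclusion map. -/
def Embeds (A B : QNSpace X) : Prop :=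
  A.carrier ⊆ B.carrier ∧ ∃ C : ℝ≥0, ∀ x ∈ A.carrier, B.qnorm x ≤ C * A.qnorm x

/-- `A = B` as quasi-normed spaces: the same elements, and equivalent quasi-norms. -/
def Identical (A B : QNSpace X) : Prop :=
  A.Embeds B ∧ B.Embeds A

/-- The elements of the algebraic sum `A₀ + A₁`. -/
def sumSet [Add X] (A₀ A₁ : QNSpace X) : Set X :=
  {x | ∃ x₀ ∈ A₀.carrier, ∃ x₁ ∈ A₁.carrier, x = x₀ + x₁}

/-- Peetre's `K`-functional `K(t, x; A₀, A₁)` (`∞` if `x ∉ A₀ + A₁`). -/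
noncomputable def K [Add X] (A₀ A₁ : QNSpace X) (t : ℝ) (x : X) : ℝ≥0∞ :=
  ⨅ (x₀ ∈ A₀.carrier) (x₁ ∈ A₁.carrier) (_ : x = x₀ + x₁),
    A₀.qnorm x₀ + ENNReal.ofReal t * A₁.qnorm x₁

end QNSpace

/-- `1/q` as a real number, for `0 < q ≤ ∞`, with `1/∞ = 0`. -/
noncomputable def recip (q : ℝ≥0∞) : ℝ := (q⁻¹).toReal

/-- `‖ u^(γ - 1/q) w(u) g(u) ‖_{q, I}`, the `L_q` (quasi-)norm in `u` with respect to Lebesgue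
measure on `I ⊆ (0, ∞)`. -/
noncomputable def wnorm (γ : ℝ) (q : ℝ≥0∞) (w : ℝ → ℝ) (g : ℝ → ℝ≥0∞) (I : Set ℝ) : ℝ≥0∞ :=
  eLpNorm (fun u : ℝ => ENNReal.ofReal (u ^ (γ - recip q) * w u) * g u) q (volume.restrict I)

/-- The triple (quasi-)norm
`‖ t^(-1/s) c(t) ‖ u^(-1/r) b(u) ‖ v^(γ-1/q) a(v) g(v) ‖_{q,(u,∞)} ‖_{r,(t,∞)} ‖_{s,(0,∞)}`. -/
noncomputable def rrNorm (γ : ℝ) (s : ℝ≥0∞) (c : ℝ → ℝ) (r : ℝ≥0∞) (b : ℝ → ℝ) (q : ℝ≥0∞)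
    (a : ℝ → ℝ) (g : ℝ → ℝ≥0∞) : ℝ≥0∞ :=
  wnorm 0 s c (fun t => wnorm 0 r b (fun u => wnorm γ q a g (Ioi u)) (Ioi t)) (Ioi 0)

/-- The extremal interpolation space `(A₀, A₁)^{R,R}_{θ,s,c,r,b,q,a}`. -/
noncomputable def rrInterpolation {X : Type*} [Add X] (A₀ A₁ : QNSpace X) (θ : ℝ) (s : ℝ≥0∞)
    (c : ℝ → ℝ) (r : ℝ≥0∞) (b : ℝ → ℝ) (q : ℝ≥0∞) (a : ℝ → ℝ) : QNSpace X where
  carrier := {x | x ∈ A₀.sumSet A₁ ∧ rrNorm (-θ) s c r b q a (fun v => A₀.K A₁ v x) < ∞}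
  qnorm x := rrNorm (-θ) s c r b q a (fun v => A₀.K A₁ v x)

/-- `f` and `g` are equivalent on `(0, ∞)`: each is at most a constant times the other. -/
def EquivOnPos (f g : ℝ → ℝ) : Prop :=
  ∃ C : ℝ, 0 < C ∧ ∀ t : ℝ, 0 < t → f t ≤ C * g t ∧ g t ≤ C * f t

/-- Slowly varying functions on `(0, ∞)` (values outside `(0, ∞)` are irrelevant). -/
structure SlowlyVarying (b : ℝ → ℝ) : Prop where
  pos : ∀ t : ℝ, 0 < t → 0 < b t
  measurable : AEMeasurable b (volume.restrict (Ioi 0))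
  increasing : ∀ ε : ℝ, 0 < ε →
    ∃ g : ℝ → ℝ, MonotoneOn g (Ioi 0) ∧ EquivOnPos (fun t => t ^ ε * b t) g
  decreasing : ∀ ε : ℝ, 0 < ε →
    ∃ g : ℝ → ℝ, AntitoneOn g (Ioi 0) ∧ EquivOnPos (fun t => t ^ (-ε) * b t) g

/-- `μ` is non-atomic: every measurable set of positive measure contains a measurable subset of
positive and strictly smaller measure. (`MeasureTheory.NoAtoms` is a weaker condition, about
singletons.) -/
def NonAtomic {Ω : Type*} [MeasurableSpace Ω] (μ : Measure Ω) : Prop :=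
  ∀ A : Set Ω, MeasurableSet A → 0 < μ A → ∃ B ⊆ A, MeasurableSet B ∧ 0 < μ B ∧ μ B < μ A

section FunctionSpaces

variable {Ω : Type*} [MeasurableSpace Ω] {μ : Measure Ω} {𝕜 : Type*} [RCLike 𝕜]

/-- The non-increasing rearrangement `f^*(t) = inf {l | μ {|f| > l} ≤ t}`. -/
noncomputable def rearr (f : Ω →ₘ[μ] 𝕜) (t : ℝ) : ℝ≥0∞ :=
  sInf {l : ℝ≥0∞ | μ {x | l < ‖f x‖ₑ} ≤ ENNReal.ofReal t}

variable (μ 𝕜)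

/-- The Lebesgue space `L_p`, `0 < p ≤ ∞`. -/
noncomputable def lebesgueSpace (p : ℝ≥0∞) : QNSpace (Ω →ₘ[μ] 𝕜) :=
  .ofQNorm fun f => eLpNorm f p μ

/-- The Lorentz space `L_{p,q}`: `‖ t^(1/p-1/q) f^*(t) ‖_{q,(0,∞)} < ∞`. -/
noncomputable def lorentzSpace (p q : ℝ≥0∞) : QNSpace (Ω →ₘ[μ] 𝕜) :=
  .ofQNorm fun f => wnorm (recip p) q (fun _ => 1) (rearr f) (Ioi 0)

/-- The Lorentz–Karamata type space `L^{R,R}_{p,(s,c,r,b,q,a)}`. -/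
noncomputable def rrLorentzKaramata (p s : ℝ≥0∞) (c : ℝ → ℝ) (r : ℝ≥0∞) (b : ℝ → ℝ) (q : ℝ≥0∞)
    (a : ℝ → ℝ) : QNSpace (Ω →ₘ[μ] 𝕜) :=
  .ofQNorm fun f => rrNorm (recip p) s c r b q a (rearr f)

end FunctionSpaces

/-- The function `u ↦ b (u^(1/κ))`. -/
noncomputable def dddot (κ : ℝ) (b : ℝ → ℝ) : ℝ → ℝ := fun u => b (u ^ (1 / κ))

/-!
Up to constants, `K(t, f; A, L_∞)` for `A = L_κ` or `A = L_{κ,∞}` lies between `t f^*(t^κ)` and an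
`ℓ_ρ` sum of the values of the same function at `t, t/2, t/4, …`. The lower bound is the weak-type
estimate for the summand in `L_{κ,∞}`; the upper bound comes from truncating `f` at the level
`f^*(t^κ)` and slicing the large part at the levels `f^*((t/2^k)^κ)`.

In logarithmic coordinates the norms `‖u^(-1/q) ⋯‖_q` are plain `L_q` norms, dilations are
translations and powers are homotheties. Hence replacing `g` by `g(·/2^k)` multiplies the triple
norm by at most a constant times `2^(-kη)`, where `η > 0` is `θ` minus the growth exponents of the
weights. If `ρ` is at most `q`, `r`, `s` and `κ`, Minkowski's inequality for the `ρ`-th powers then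
sums the dyadic pieces, so the triple norm of `K(·, f)` is equivalent to that of `t f^*(t^κ)`.
The substitution `v = u^(1/κ)` turns the latter into the quasi-norm of `L^{R,R}`.
-/

section Convexity

variable {α ι : Type*} [MeasurableSpace α] {ν : Measure α} {q : ℝ≥0∞} {ρ σ : ℝ}

theorem eLpNorm_ennreal_const_mul {C : ℝ≥0∞} (hC₀ : C ≠ 0) (hC : C ≠ ∞) (G : α → ℝ≥0∞)
    (q : ℝ≥0∞) : eLpNorm (fun x => C * G x) q ν = C * eLpNorm G q ν := by
  lift C to ℝ≥0 using hC
  refine le_antisymm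
    (eLpNorm_le_nnreal_smul_eLpNorm_of_ae_le_mul' (.of_forall fun x => le_rfl) q) ?_
  have hC' : C ≠ 0 := by simpa using hC₀
  rw [ENNReal.mul_le_iff_le_inv hC₀ ENNReal.coe_ne_top, ← ENNReal.coe_inv hC']
  refine eLpNorm_le_nnreal_smul_eLpNorm_of_ae_le_mul' (.of_forall fun x => le_of_eq ?_) q
  simp only [enorm_eq_self]
  rw [← mul_assoc, ← ENNReal.coe_mul, inv_mul_cancel₀ hC', ENNReal.coe_one, one_mul]

theorem lintegral_tsum_rpow_eq_iSup [Countable ι] {F : ι → α → ℝ≥0∞}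
    (hF : ∀ i, AEMeasurable (F i) ν) (hσ : 0 < σ) :
    ∫⁻ x, (∑' i, F i x) ^ σ ∂ν = ⨆ T : Finset ι, ∫⁻ x, (∑ i ∈ T, F i x) ^ σ ∂ν := by
  rw [← lintegral_iSup_directed
    (fun T => (Finset.aemeasurable_fun_sum T fun i _ => hF i).pow_const σ)]
  · simp_rw [ENNReal.tsum_eq_iSup_sum]
    exact lintegral_congr fun x => (ENNReal.orderIsoRpow σ hσ).map_iSup _
  · refine Monotone.directed_le fun S T hST x => ?_
    dsimp only
    gcongr

theorem eLpNorm_tsum_le_tsum [Countable ι] {F : ι → α → ℝ≥0∞}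
    (hF : ∀ i, AEMeasurable (F i) ν) (hq : 1 ≤ q) :
    eLpNorm (fun x => ∑' i, F i x) q ν ≤ ∑' i, eLpNorm (F i) q ν := by
  rcases eq_or_ne q ∞ with rfl | hqt
  · simp only [eLpNorm_exponent_top]
    refine essSup_le_of_ae_le _ ?_
    filter_upwards [ae_all_iff.2 fun i => enorm_ae_le_eLpNormEssSup (F i) ν] with x hx
    exact ENNReal.tsum_le_tsum hx
  · have hq0 : q ≠ 0 := (zero_lt_one.trans_le hq).ne'
    have hqr : 0 < q.toReal := ENNReal.toReal_pos hq0 hqt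
    simp only [eLpNorm_eq_lintegral_rpow_enorm_toReal hq0 hqt, enorm_eq_self, one_div,
      ENNReal.rpow_inv_le_iff hqr, lintegral_tsum_rpow_eq_iSup hF hqr]
    refine iSup_le fun T => ?_
    rw [← ENNReal.rpow_inv_le_iff hqr]
    have hT := eLpNorm_sum_le (s := T) (fun i _ => (hF i).aestronglyMeasurable) hq
    simp only [eLpNorm_eq_lintegral_rpow_enorm_toReal hq0 hqt, enorm_eq_self, one_div,
      Finset.sum_apply] at hT
    exact hT.trans (ENNReal.sum_le_tsum T)

theorem eLpNorm_tsum_rpow_le [Countable ι] {F : ι → α → ℝ≥0∞}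
    (hF : ∀ i, AEMeasurable (F i) ν) (hρ : 0 < ρ) (hq : ENNReal.ofReal ρ ≤ q) :
    eLpNorm (fun x => (∑' i, F i x ^ ρ) ^ (1 / ρ)) q ν
      ≤ (∑' i, eLpNorm (F i) q ν ^ ρ) ^ (1 / ρ) := by
  have hρ0 : ENNReal.ofReal ρ ≠ 0 := by simpa using hρ
  have hpow : ∀ G : α → ℝ≥0∞,
      eLpNorm (fun x => G x ^ ρ) (q / ENNReal.ofReal ρ) ν = eLpNorm G q ν ^ ρ := fun G => by
    simpa [ENNReal.div_mul_cancel hρ0 ENNReal.ofReal_ne_top]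
      using eLpNorm_enorm_rpow (p := q / ENNReal.ofReal ρ) (μ := ν) G hρ
  rw [one_div, ENNReal.le_rpow_inv_iff hρ, ← hpow]
  simp only [ENNReal.rpow_inv_rpow hρ.ne', ← hpow]
  refine eLpNorm_tsum_le_tsum (fun i => (hF i).pow_const ρ) ?_
  rwa [ENNReal.le_div_iff_mul_le (Or.inl hρ0) (Or.inl ENNReal.ofReal_ne_top), one_mul]

theorem tsum_rpow_rpow_antitone (x : ι → ℝ≥0∞) (hρ : 0 < ρ) (h : ρ ≤ σ) :
    (∑' i, x i ^ σ) ^ (1 / σ) ≤ (∑' i, x i ^ ρ) ^ (1 / ρ) := by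
  have hσ : 0 < σ := hρ.trans_le h
  set S := ∑' i, x i ^ ρ
  have split (y : ℝ≥0∞) : (y ^ ρ) * (y ^ ρ) ^ (σ / ρ - 1) = y ^ σ := by
    rw [← ENNReal.rpow_mul, mul_sub, mul_div_cancel₀ _ hρ.ne', mul_one,
      ← ENNReal.rpow_add_of_nonneg _ _ hρ.le (sub_nonneg.2 h), add_sub_cancel]
  have hS : ∑' i, x i ^ σ ≤ S * S ^ (σ / ρ - 1) := by
    rw [← ENNReal.tsum_mul_right]
    refine ENNReal.tsum_le_tsum fun i => ?_
    rw [← split]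
    gcongr
    · rw [sub_nonneg, le_div_iff₀ hρ]; linarith
    · exact ENNReal.le_tsum i
  have hS' : S = (S ^ (1 / ρ)) ^ ρ := by
    rw [one_div, ENNReal.rpow_inv_rpow hρ.ne']
  rw [one_div σ, ENNReal.rpow_inv_le_iff hσ, ← split, ← hS']
  exact hS

end Convexity

section WeightedNorms

variable {γ γ' ρ : ℝ} {q r s : ℝ≥0∞} {a a' b b' c c' w w' : ℝ → ℝ} {g g' : ℝ → ℝ≥0∞} {I : Set ℝ}
  {A B C : ℝ≥0}

theorem wnorm_congr (hI : MeasurableSet I)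
    (h : ∀ u ∈ I, ENNReal.ofReal (u ^ (γ - recip q) * w u) * g u
      = ENNReal.ofReal (u ^ (γ' - recip q) * w' u) * g' u) :
    wnorm γ q w g I = wnorm γ' q w' g' I :=
  eLpNorm_congr_ae <| (ae_restrict_iff' hI).2 <| .of_forall h

theorem wnorm_le_mul_wnorm (hI : I ⊆ Ioi 0) (hIm : MeasurableSet I)
    (h : ∀ u ∈ I, ENNReal.ofReal (w u) * g u ≤ C * (ENNReal.ofReal (w' u) * g' u)) :
    wnorm γ q w g I ≤ C * wnorm γ q w' g' I := by
  refine eLpNorm_le_nnreal_smul_eLpNorm_of_ae_le_mul' ?_ q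
  filter_upwards [ae_restrict_mem hIm] with u hu
  simp only [enorm_eq_self, ENNReal.ofReal_mul (Real.rpow_nonneg (hI hu).le _), mul_assoc]
  rw [mul_left_comm (C : ℝ≥0∞)]
  exact mul_le_mul_right (h u hu) _

theorem wnorm_const_mul {C : ℝ≥0∞} (hC₀ : C ≠ 0) (hC : C ≠ ∞) :
    wnorm γ q w (fun u => C * g u) I = C * wnorm γ q w g I := by
  simp only [wnorm, ← eLpNorm_ennreal_const_mul hC₀ hC, mul_left_comm]

theorem wnorm_Ioi_antitone (γ : ℝ) (q : ℝ≥0∞) (w : ℝ → ℝ) (g : ℝ → ℝ≥0∞) :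
    Antitone fun u => wnorm γ q w g (Ioi u) := fun _ _ h =>
  eLpNorm_mono_measure _ (Measure.restrict_mono_set _ (Ioi_subset_Ioi h))

theorem wnorm_tsum_rpow_le {ι : Type*} [Countable ι] {g : ι → ℝ → ℝ≥0∞} (hI : I ⊆ Ioi 0)
    (hw : AEMeasurable w (volume.restrict (Ioi 0))) (hg : ∀ i, Measurable (g i)) (hρ : 0 < ρ)
    (hq : ENNReal.ofReal ρ ≤ q) :
    wnorm γ q w (fun v => (∑' i, g i v ^ ρ) ^ (1 / ρ)) I
      ≤ (∑' i, wnorm γ q w (g i) I ^ ρ) ^ (1 / ρ) := by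
  have hw' : AEMeasurable (fun u : ℝ => ENNReal.ofReal (u ^ (γ - recip q) * w u))
      (volume.restrict I) :=
    ((by fun_prop : Measurable fun u : ℝ => u ^ (γ - recip q)).aemeasurable.mul
      (hw.mono_measure (Measure.restrict_mono_set _ hI))).ennreal_ofReal
  refine le_trans (le_of_eq ?_)
    (eLpNorm_tsum_rpow_le (fun i => hw'.mul (hg i).aemeasurable) hρ hq)
  refine congrArg (eLpNorm · q _) (funext fun v => ?_)
  simp only [ENNReal.mul_rpow_of_nonneg _ _ hρ.le, ENNReal.tsum_mul_left, one_div,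
    ENNReal.mul_rpow_of_nonneg _ _ (inv_nonneg.2 hρ.le), ENNReal.rpow_rpow_inv hρ.ne']

theorem wnorm_Ioi_eq_top (hq : q ≠ 0) (hw : ∀ v, 0 < v → 0 < w v) {u : ℝ} (hu : 0 ≤ u)
    (hg : ∀ v, u < v → g v = ∞) : wnorm γ q w g (Ioi u) = ∞ := by
  have h : (fun v : ℝ => ENNReal.ofReal (v ^ (γ - recip q) * w v) * g v)
      =ᵐ[volume.restrict (Ioi u)] fun _ => ∞ := by
    filter_upwards [ae_restrict_mem measurableSet_Ioi] with v hv
    have hv₀ : 0 < v := hu.trans_lt hv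
    rw [hg v hv, ENNReal.mul_top]
    simpa using mul_pos (Real.rpow_pos_of_pos hv₀ _) (hw v hv₀)
  rw [wnorm, eLpNorm_congr_ae h, eLpNorm_const _ hq (by simp [Measure.restrict_eq_zero])]
  simp [ENNReal.top_mul, ENNReal.rpow_eq_zero_iff]

theorem rrNorm_congr
    (h : ∀ v, 0 < v → ENNReal.ofReal (v ^ (γ - recip q) * a v) * g v
      = ENNReal.ofReal (v ^ (γ' - recip q) * a' v) * g' v) :
    rrNorm γ s c r b q a g = rrNorm γ' s c r b q a' g' := by
  refine wnorm_congr measurableSet_Ioi fun t ht => congrArg _ ?_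
  refine wnorm_congr measurableSet_Ioi fun u hu => congrArg _ ?_
  exact wnorm_congr measurableSet_Ioi fun v hv => h v ((ht.trans hu).trans hv)

theorem rrNorm_rpow_mul (γ α : ℝ) (g : ℝ → ℝ≥0∞) :
    rrNorm γ s c r b q a (fun v => ENNReal.ofReal (v ^ α) * g v)
      = rrNorm (γ + α) s c r b q a g := by
  refine rrNorm_congr fun v hv => ?_
  rw [← mul_assoc, ← ENNReal.ofReal_mul' (Real.rpow_nonneg hv.le α), mul_right_comm,
    ← Real.rpow_add hv, sub_add_eq_add_sub]

theorem rrNorm_le_mul_rrNorm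
    (ha : ∀ v, 0 < v → ENNReal.ofReal (a v) * g v ≤ A * (ENNReal.ofReal (a' v) * g' v))
    (hb : ∀ v, 0 < v → ENNReal.ofReal (b v) ≤ B * ENNReal.ofReal (b' v))
    (hc : ∀ v, 0 < v → ENNReal.ofReal (c v) ≤ C * ENNReal.ofReal (c' v)) :
    rrNorm γ s c r b q a g ≤ (C * (B * A) : ℝ≥0) * rrNorm γ s c' r b' q a' g' := by
  have outer {x x' y y' : ℝ≥0∞} {D E : ℝ≥0} (hx : x ≤ D * x') (hy : y ≤ E * y') :
      x * y ≤ (D * E : ℝ≥0) * (x' * y') := by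
    rw [ENNReal.coe_mul, mul_mul_mul_comm]
    exact mul_le_mul' hx hy
  refine wnorm_le_mul_wnorm subset_rfl measurableSet_Ioi fun t ht => outer (hc t ht) ?_
  refine wnorm_le_mul_wnorm (Ioi_subset_Ioi ht.le) measurableSet_Ioi fun u hu =>
    outer (hb u (ht.trans hu)) ?_
  exact wnorm_le_mul_wnorm (Ioi_subset_Ioi (ht.trans hu).le) measurableSet_Ioi fun v hv =>
    ha v ((ht.trans hu).trans hv)

theorem rrNorm_le_const_mul (h : ∀ v, 0 < v → g v ≤ A * g' v) :
    rrNorm γ s c r b q a g ≤ A * rrNorm γ s c r b q a g' := by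
  simpa using rrNorm_le_mul_rrNorm (B := 1) (C := 1) (a := a) (a' := a) (b := b) (b' := b)
    (c := c) (c' := c) (γ := γ) (q := q) (r := r) (s := s)
    (fun v hv => (mul_le_mul_right (h v hv) _).trans_eq (mul_left_comm _ _ _)) (by simp) (by simp)

theorem exists_lt_top_of_rrNorm_lt_top (hq : q ≠ 0) (hr : r ≠ 0) (hs : s ≠ 0)
    (ha : ∀ v, 0 < v → 0 < a v) (hb : ∀ v, 0 < v → 0 < b v) (hc : ∀ v, 0 < v → 0 < c v)
    (h : rrNorm γ s c r b q a g < ∞) : ∃ v, 0 < v ∧ g v < ∞ := by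
  by_contra! hg
  refine h.ne (wnorm_Ioi_eq_top hs hc le_rfl fun t ht => ?_)
  refine wnorm_Ioi_eq_top hr hb ht.le fun u hu => ?_
  exact wnorm_Ioi_eq_top hq ha (ht.trans hu).le fun v hv =>
    top_le_iff.1 (hg v ((ht.trans hu).trans hv))

theorem rrNorm_tsum_rpow_le {ι : Type*} [Countable ι] {g : ι → ℝ → ℝ≥0∞}
    (ha : AEMeasurable a (volume.restrict (Ioi 0))) (hb : AEMeasurable b (volume.restrict (Ioi 0)))
    (hc : AEMeasurable c (volume.restrict (Ioi 0))) (hg : ∀ i, Measurable (g i)) (hρ : 0 < ρ)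
    (hq : ENNReal.ofReal ρ ≤ q) (hr : ENNReal.ofReal ρ ≤ r) (hs : ENNReal.ofReal ρ ≤ s) :
    rrNorm γ s c r b q a (fun v => (∑' i, g i v ^ ρ) ^ (1 / ρ))
      ≤ (∑' i, rrNorm γ s c r b q a (g i) ^ ρ) ^ (1 / ρ) := by
  have mono {γ : ℝ} {q : ℝ≥0∞} {w : ℝ → ℝ} {G G' : ℝ → ℝ≥0∞} {t : ℝ} (ht : 0 ≤ t)
      (h : ∀ u, t < u → G u ≤ G' u) : wnorm γ q w G (Ioi t) ≤ wnorm γ q w G' (Ioi t) := by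
    simpa using wnorm_le_mul_wnorm (C := 1) (Ioi_subset_Ioi ht) measurableSet_Ioi
      fun u hu => by simpa using mul_le_mul_right (h u hu) (ENNReal.ofReal (w u))
  refine (mono le_rfl fun t ht => ?_).trans (wnorm_tsum_rpow_le subset_rfl hc
    (fun i => (wnorm_Ioi_antitone 0 r b _).measurable) hρ hs)
  refine (mono ht.le fun u hu => ?_).trans (wnorm_tsum_rpow_le (Ioi_subset_Ioi ht.le) hb
    (fun i => (wnorm_Ioi_antitone γ q a (g i)).measurable) hρ hr)
  exact wnorm_tsum_rpow_le (Ioi_subset_Ioi (ht.trans hu).le) ha hg hρ hq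

end WeightedNorms

section LogarithmicCoordinates

variable {γ l β u : ℝ} {q r s : ℝ≥0∞} {I : Set ℝ}

theorem map_exp_withDensity_exp (hI : I ⊆ Ioi 0) (hIm : MeasurableSet I) :
    ((volume.restrict (Real.exp ⁻¹' I)).withDensity fun y => ENNReal.ofReal (Real.exp y)).map
      Real.exp = volume.restrict I := by
  have h := map_withDensity_abs_det_fderiv_eq_addHaar volume
    (Real.measurable_exp hIm).nullMeasurableSet
    (fun y _ => (Real.hasDerivAt_exp y).hasFDerivAt.hasFDerivWithinAt) Real.exp_injective.injOn
  rw [image_preimage_eq_of_subset (by rwa [Real.range_exp])] at h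
  simpa only [ContinuousLinearMap.det_toSpanSingleton, Real.abs_exp] using h

theorem eLpNorm_comp_exp (hq : q ≠ 0) (hI : I ⊆ Ioi 0) (hIm : MeasurableSet I) (G : ℝ → ℝ≥0∞) :
    eLpNorm (fun y => G (Real.exp y)) q (volume.restrict (Real.exp ⁻¹' I))
      = eLpNorm (fun x => ENNReal.ofReal (x ^ (-recip q)) * G x) q (volume.restrict I) := by
  have hdens : Measurable fun y => ENNReal.ofReal (Real.exp y) := by fun_prop
  rw [← map_exp_withDensity_exp hI hIm,
    Real.isOpenEmbedding_exp.measurableEmbedding.eLpNorm_map_measure]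
  rcases eq_or_ne q ∞ with rfl | hqt
  · simp only [Function.comp_def, recip, ENNReal.inv_top, ENNReal.toReal_zero, neg_zero,
      Real.rpow_zero, ENNReal.ofReal_one, one_mul, eLpNorm_exponent_top]
    refine le_antisymm (essSup_mono_measure (withDensity_absolutelyContinuous' hdens.aemeasurable
      (.of_forall fun y => ?_))) (essSup_mono_measure (withDensity_absolutelyContinuous _ _))
    simpa using Real.exp_pos y
  · have hqr : 0 < q.toReal := ENNReal.toReal_pos hq hqt
    rw [eLpNorm_eq_lintegral_rpow_enorm_toReal hq hqt,
      eLpNorm_eq_lintegral_rpow_enorm_toReal hq hqt,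
      lintegral_withDensity_eq_lintegral_mul_non_measurable _ hdens (by simp)]
    congr 2 with y
    simp only [Function.comp_apply, Pi.mul_apply, enorm_eq_self,
      ENNReal.mul_rpow_of_nonneg _ _ hqr.le]
    rw [ENNReal.ofReal_rpow_of_nonneg (by positivity) hqr.le, ← mul_assoc,
      ← ENNReal.ofReal_mul (by positivity), ← Real.exp_mul, ← Real.exp_mul, ← Real.exp_add]
    simp [recip, hqr.ne']

theorem wnorm_eq_eLpNorm_exp (hq : q ≠ 0) (hI : I ⊆ Ioi 0) (hIm : MeasurableSet I) (γ : ℝ)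
    (w : ℝ → ℝ) (g : ℝ → ℝ≥0∞) :
    wnorm γ q w g I = eLpNorm
      (fun y => ENNReal.ofReal (Real.exp (γ * y) * w (Real.exp y)) * g (Real.exp y)) q
      (volume.restrict (Real.exp ⁻¹' I)) := by
  simp only [mul_comm γ, Real.exp_mul]
  rw [eLpNorm_comp_exp hq hI hIm fun x => ENNReal.ofReal (x ^ γ * w x) * g x]
  refine eLpNorm_congr_ae ?_
  filter_upwards [ae_restrict_mem hIm] with x hx
  have hx0 : 0 < x := hI hx
  rw [← mul_assoc, ← ENNReal.ofReal_mul (by positivity), ← mul_assoc, ← Real.rpow_add hx0,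
    neg_add_eq_sub]

theorem eLpNorm_restrict_preimage_affine (hβ : 0 < β) (m : ℝ) (q : ℝ≥0∞) (G : ℝ → ℝ≥0∞)
    (S : Set ℝ) :
    eLpNorm G q (volume.restrict S) = ENNReal.ofReal (β ^ recip q) *
      eLpNorm (fun y => G (m + β * y)) q (volume.restrict ((fun y => m + β * y) ⁻¹' S)) := by
  have hA : MeasurableEmbedding fun y : ℝ => m + β * y :=
    ((Homeomorph.mulLeft₀ β hβ.ne').trans (Homeomorph.addLeft m)).measurableEmbedding
  have hmap : ENNReal.ofReal β • (volume : Measure ℝ).map (fun y => m + β * y) = volume := by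
    have h := Real.smul_map_volume_mul_left hβ.ne'
    rw [abs_of_pos hβ] at h
    conv_rhs => rw [← map_add_left_eq_self volume m, ← h]
    rw [Measure.map_smul, Measure.map_map (by fun_prop) (by fun_prop)]
    rfl
  conv_lhs => rw [← hmap, Measure.restrict_smul, hA.restrict_map]
  rw [eLpNorm_smul_measure_of_ne_zero (by simpa using hβ), hA.eLpNorm_map_measure, smul_eq_mul,
    one_div, ENNReal.ofReal_rpow_of_pos hβ]
  rfl

theorem wnorm_Ioi_mul_rpow (hq : q ≠ 0) (hl : 0 < l) (hβ : 0 < β) (hu : 0 ≤ u) (γ : ℝ)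
    (w : ℝ → ℝ) (g : ℝ → ℝ≥0∞) :
    wnorm γ q w g (Ioi (l * u ^ β)) = ENNReal.ofReal (l ^ γ * β ^ recip q) *
      wnorm (γ * β) q (fun x => w (l * x ^ β)) (fun x => g (l * x ^ β)) (Ioi u) := by
  have hexp (y : ℝ) : Real.exp (Real.log l + β * y) = l * Real.exp y ^ β := by
    rw [Real.exp_add, Real.exp_log hl, mul_comm β, Real.exp_mul]
  have hpre : (fun y => Real.log l + β * y) ⁻¹' (Real.exp ⁻¹' Ioi (l * u ^ β))
      = Real.exp ⁻¹' Ioi u := by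
    ext y
    simp only [mem_preimage, hexp, mem_Ioi, mul_lt_mul_iff_right₀ hl]
    exact Real.rpow_lt_rpow_iff hu (Real.exp_pos y).le hβ
  rw [wnorm_eq_eLpNorm_exp hq (Ioi_subset_Ioi (by positivity)) measurableSet_Ioi,
    wnorm_eq_eLpNorm_exp hq (Ioi_subset_Ioi hu) measurableSet_Ioi,
    eLpNorm_restrict_preimage_affine hβ (Real.log l) q, hpre]
  rw [mul_comm (l ^ γ), ENNReal.ofReal_mul (by positivity), mul_assoc,
    ← eLpNorm_ennreal_const_mul (C := ENNReal.ofReal (l ^ γ))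
      (by simpa using Real.rpow_pos_of_pos hl γ) ENNReal.ofReal_ne_top]
  congr 2 with y
  rw [hexp, ← mul_assoc, ← ENNReal.ofReal_mul (by positivity), ← mul_assoc,
    Real.rpow_def_of_pos hl, ← Real.exp_add, mul_add, mul_comm γ (Real.log l), mul_assoc γ]

theorem rrNorm_comp_mul_rpow (hq : q ≠ 0) (hr : r ≠ 0) (hs : s ≠ 0) (hl : 0 < l) (hβ : 0 < β)
    (γ : ℝ) (a b c : ℝ → ℝ) (g : ℝ → ℝ≥0∞) :
    rrNorm γ s c r b q a g = ENNReal.ofReal (l ^ γ * β ^ (recip q + recip r + recip s)) *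
      rrNorm (γ * β) s (fun x => c (l * x ^ β)) r (fun x => b (l * x ^ β)) q
        (fun x => a (l * x ^ β)) (fun x => g (l * x ^ β)) := by
  have ofReal_ne_zero {x : ℝ} (hx : 0 < x) : ENNReal.ofReal x ≠ 0 := by simpa using hx
  have outer {p : ℝ≥0∞} (hp : p ≠ 0) {t C : ℝ} (ht : 0 ≤ t) (hC : 0 < C) {w : ℝ → ℝ}
      {G G' : ℝ → ℝ≥0∞} (hG : ∀ u, 0 < u → G (l * u ^ β) = ENNReal.ofReal C * G' u) :
      wnorm 0 p w G (Ioi (l * t ^ β)) = ENNReal.ofReal (C * β ^ recip p) *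
        wnorm 0 p (fun x => w (l * x ^ β)) G' (Ioi t) := by
    rw [wnorm_Ioi_mul_rpow hp hl hβ ht, zero_mul, Real.rpow_zero, one_mul, mul_comm C,
      ENNReal.ofReal_mul (by positivity), mul_assoc,
      ← wnorm_const_mul (ofReal_ne_zero hC) ENNReal.ofReal_ne_top]
    exact congrArg _ (wnorm_congr measurableSet_Ioi fun u hu => by rw [hG u (ht.trans_lt hu)])
  have middle (t : ℝ) (ht : 0 < t) := outer hr ht.le (by positivity) (w := b)
    (G := fun u => wnorm γ q a g (Ioi u)) fun u hu => wnorm_Ioi_mul_rpow hq hl hβ hu.le γ a g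
  have h := outer hs le_rfl (by positivity) (w := c)
    (G := fun t => wnorm 0 r b (fun u => wnorm γ q a g (Ioi u)) (Ioi t)) middle
  rwa [Real.zero_rpow hβ.ne', mul_zero, mul_assoc, mul_assoc, ← mul_assoc (β ^ recip q),
    ← Real.rpow_add hβ, ← Real.rpow_add hβ] at h

end LogarithmicCoordinates

/-- Weights of upper type `ε` on `(0, ∞)`: positive functions whose dilation by `l ≥ 1` costs at
most a constant times `l ^ ε`. Slowly varying functions are of upper type `ε` for every `ε > 0`. -/
structure UpperType (ε : ℝ) (w : ℝ → ℝ) : Prop where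
  pos : ∀ v, 0 < v → 0 < w v
  aemeasurable : AEMeasurable w (volume.restrict (Ioi 0))
  exists_dilation_le : ∃ C : ℝ, ∀ l, 1 ≤ l → ∀ v, 0 < v → w (l * v) ≤ C * l ^ ε * w v

/-- The `ℓ_ρ` sum of the values of `g` at the dyadic points `t, t / 2, t / 4, …`. -/
noncomputable def dyadicSum (ρ : ℝ) (g : ℝ → ℝ≥0∞) (t : ℝ) : ℝ≥0∞ :=
  (∑' k : ℕ, g (t / 2 ^ k) ^ ρ) ^ (1 / ρ)

section Dilations

variable {ε α β γ δ ρ : ℝ} {q r s : ℝ≥0∞} {a b c w : ℝ → ℝ}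

theorem SlowlyVarying.upperType (hw : SlowlyVarying w) (hε : 0 < ε) : UpperType ε w where
  pos := hw.pos
  aemeasurable := hw.measurable
  exists_dilation_le := by
    obtain ⟨g, hg, C, hC, h⟩ := hw.decreasing ε hε
    refine ⟨C * C, fun l hl v hv => ?_⟩
    have hl₀ : 0 < l := zero_lt_one.trans_le hl
    have hlv : 0 < l * v := by positivity
    have hchain : (l * v) ^ (-ε) * w (l * v) ≤ C * (C * (v ^ (-ε) * w v)) := calc
      _ ≤ C * g (l * v) := (h _ hlv).1
      _ ≤ C * g v := by gcongr; exact hg hv hlv (le_mul_of_one_le_left hv.le hl)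
      _ ≤ _ := by gcongr; exact (h v hv).2
    rw [Real.rpow_neg hlv.le, inv_mul_le_iff₀ (by positivity)] at hchain
    refine hchain.trans_eq ?_
    rw [Real.mul_rpow hl₀.le hv.le, Real.rpow_neg hv.le]
    field_simp

theorem UpperType.exists_ofReal_le (hw : UpperType ε w) :
    ∃ C : ℝ≥0, ∀ l, 1 ≤ l → ∀ v, 0 < v →
      ENNReal.ofReal (w (l * v)) ≤ (C * (l ^ ε).toNNReal : ℝ≥0) * ENNReal.ofReal (w v) := by
  obtain ⟨C, hC⟩ := hw.exists_dilation_le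
  refine ⟨C.toNNReal, fun l hl v hv => ?_⟩
  rw [ENNReal.coe_mul, ← ENNReal.ofReal, ← ENNReal.ofReal, ← ENNReal.ofReal_mul' (by positivity),
    ← ENNReal.ofReal_mul' (hw.pos v hv).le]
  exact ENNReal.ofReal_le_ofReal (hC l hl v hv)

theorem rrNorm_dilation_le (hq : q ≠ 0) (hr : r ≠ 0) (hs : s ≠ 0) (ha : UpperType α a)
    (hb : UpperType β b) (hc : UpperType δ c) (γ : ℝ) :
    ∃ C : ℝ≥0, ∀ l, 1 ≤ l → ∀ g, rrNorm γ s c r b q a (fun v => g (v / l))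
      ≤ C * ENNReal.ofReal (l ^ (γ + α + β + δ)) * rrNorm γ s c r b q a g := by
  obtain ⟨A, hA⟩ := ha.exists_ofReal_le
  obtain ⟨B, hB⟩ := hb.exists_ofReal_le
  obtain ⟨D, hD⟩ := hc.exists_ofReal_le
  refine ⟨D * (B * A), fun l hl g => ?_⟩
  have hl₀ : 0 < l := zero_lt_one.trans_le hl
  rw [rrNorm_comp_mul_rpow hq hr hs hl₀ one_pos]
  simp only [Real.rpow_one, Real.one_rpow, mul_one, mul_div_cancel_left₀ _ hl₀.ne']
  have h := rrNorm_le_mul_rrNorm (γ := γ) (q := q) (r := r) (s := s) (g := g) (g' := g)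
    (fun v hv => by rw [← mul_assoc]; exact mul_le_mul_left (hA l hl v hv) _) (hB l hl) (hD l hl)
  refine (mul_le_mul_right h _).trans_eq ?_
  rw [← mul_assoc, Real.rpow_add hl₀, Real.rpow_add hl₀, Real.rpow_add hl₀,
    ENNReal.ofReal_mul (by positivity), ENNReal.ofReal_mul (by positivity),
    ENNReal.ofReal_mul (by positivity)]
  simp only [ENNReal.ofReal, ENNReal.coe_mul]
  ring

theorem dyadicSum_antitone {σ : ℝ} (hρ : 0 < ρ) (h : ρ ≤ σ) (g : ℝ → ℝ≥0∞) (t : ℝ) :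
    dyadicSum σ g t ≤ dyadicSum ρ g t :=
  tsum_rpow_rpow_antitone _ hρ h

theorem tsum_const_mul_pow_rpow_rpow (hρ : 0 < ρ) (A x : ℝ≥0∞) :
    (∑' k : ℕ, (A * x ^ k) ^ ρ) ^ (1 / ρ) = A * (1 - x ^ ρ)⁻¹ ^ (1 / ρ) := by
  have hpow (k : ℕ) : (A * x ^ k) ^ ρ = A ^ ρ * (x ^ ρ) ^ k := by
    rw [ENNReal.mul_rpow_of_nonneg _ _ hρ.le, ← ENNReal.rpow_natCast_mul,
      ← ENNReal.rpow_mul_natCast, mul_comm (k : ℝ)]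
  simp only [hpow, ENNReal.tsum_mul_left, ENNReal.tsum_geometric]
  rw [ENNReal.mul_rpow_of_nonneg _ _ (by positivity), one_div, ENNReal.rpow_rpow_inv hρ.ne']

theorem rrNorm_dyadicSum_le (ha : UpperType α a) (hb : UpperType β b) (hc : UpperType δ c)
    (hγ : γ + α + β + δ < 0) (hρ : 0 < ρ) (hq : ENNReal.ofReal ρ ≤ q) (hr : ENNReal.ofReal ρ ≤ r)
    (hs : ENNReal.ofReal ρ ≤ s) :
    ∃ C : ℝ≥0, ∀ g, Measurable g →
      rrNorm γ s c r b q a (dyadicSum ρ g) ≤ C * rrNorm γ s c r b q a g := by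
  have ne_zero {p : ℝ≥0∞} (hp : ENNReal.ofReal ρ ≤ p) : p ≠ 0 :=
    ((ENNReal.ofReal_pos.2 hρ).trans_le hp).ne'
  obtain ⟨C, hC⟩ := rrNorm_dilation_le (ne_zero hq) (ne_zero hr) (ne_zero hs) ha hb hc γ
  set x := ENNReal.ofReal (2 ^ (γ + α + β + δ)) with hx
  have hpow (k : ℕ) : ENNReal.ofReal ((2 ^ k) ^ (γ + α + β + δ)) = x ^ k := by
    rw [hx, ← ENNReal.ofReal_pow (by positivity), Real.rpow_pow_comm zero_le_two]
  have hx₁ : x ^ ρ < 1 := by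
    refine ENNReal.rpow_lt_one ?_ hρ
    rw [hx, ENNReal.ofReal_lt_one]
    exact Real.rpow_lt_one_of_one_lt_of_neg one_lt_two hγ
  have hfin : (1 - x ^ ρ)⁻¹ ^ (1 / ρ) ≠ ∞ := ENNReal.rpow_ne_top_of_nonneg (by positivity)
    (ENNReal.inv_ne_top.2 (tsub_pos_of_lt hx₁).ne')
  refine ⟨C * ((1 - x ^ ρ)⁻¹ ^ (1 / ρ)).toNNReal, fun g hg => ?_⟩
  calc
    _ ≤ (∑' k : ℕ, rrNorm γ s c r b q a (fun v => g (v / 2 ^ k)) ^ ρ) ^ (1 / ρ) :=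
      rrNorm_tsum_rpow_le ha.aemeasurable hb.aemeasurable hc.aemeasurable
        (fun k => hg.comp (measurable_id.div_const _)) hρ hq hr hs
    _ ≤ (∑' k : ℕ, (C * rrNorm γ s c r b q a g * x ^ k) ^ ρ) ^ (1 / ρ) := by
      gcongr with k
      exact (hC _ (one_le_pow₀ one_le_two) g).trans_eq (by rw [hpow, mul_right_comm])
    _ = _ := by
      rw [tsum_const_mul_pow_rpow_rpow hρ, ENNReal.coe_mul, ENNReal.coe_toNNReal hfin,
        mul_right_comm]

end Dilations

namespace QNSpace

section KFunctional

variable {X : Type*} {A B C A₀ A₁ B₀ B₁ : QNSpace X}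

theorem Embeds.refl (A : QNSpace X) : A.Embeds A :=
  ⟨subset_rfl, 1, fun x _ => by simp⟩

theorem Embeds.trans (h₁ : A.Embeds B) (h₂ : B.Embeds C) : A.Embeds C := by
  obtain ⟨s₁, C₁, b₁⟩ := h₁
  obtain ⟨s₂, C₂, b₂⟩ := h₂
  refine ⟨s₁.trans s₂, C₂ * C₁, fun x hx => (b₂ x (s₁ hx)).trans ?_⟩
  rw [ENNReal.coe_mul, mul_assoc]
  exact mul_le_mul_right (b₁ x hx) _

variable [Add X] {N₀ N₁ : X → ℝ≥0∞} {t : ℝ} {x : X}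

theorem mem_sumSet_of_K_lt_top (h : A₀.K A₁ t x < ∞) : x ∈ A₀.sumSet A₁ := by
  simp only [K, iInf_lt_iff] at h
  obtain ⟨x₀, h₀, x₁, h₁, hx, -⟩ := h
  exact ⟨x₀, h₀, x₁, h₁, hx⟩

theorem K_ofQNorm_add_le (ht : 0 < t) (x₀ x₁ : X) :
    (ofQNorm N₀).K (ofQNorm N₁) t (x₀ + x₁) ≤ N₀ x₀ + ENNReal.ofReal t * N₁ x₁ := by
  rcases eq_or_ne (N₀ x₀) ∞ with h₀ | h₀
  · simp [h₀]
  rcases eq_or_ne (N₁ x₁) ∞ with h₁ | h₁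
  · simp [h₁, ENNReal.mul_top, ht]
  exact iInf₂_le_of_le x₀ h₀.lt_top <| iInf₂_le_of_le x₁ h₁.lt_top <| iInf_le _ rfl

theorem Embeds.exists_K_le (h₀ : A₀.Embeds B₀) (h₁ : A₁.Embeds B₁) :
    ∃ C : ℝ≥0, ∀ t x, B₀.K B₁ t x ≤ C * A₀.K A₁ t x := by
  obtain ⟨s₀, C₀, b₀⟩ := h₀
  obtain ⟨s₁, C₁, b₁⟩ := h₁
  refine ⟨max 1 (max C₀ C₁), fun t x => ?_⟩
  have hne : ((max 1 (max C₀ C₁) : ℝ≥0) : ℝ≥0∞) ≠ 0 :=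
    ENNReal.coe_ne_zero.2 (zero_lt_one.trans_le (le_max_left _ _)).ne'
  simp only [K, ENNReal.mul_iInf_of_ne hne ENNReal.coe_ne_top]
  refine le_iInf₂ fun x₀ m₀ => le_iInf₂ fun x₁ m₁ => le_iInf fun hx => ?_
  refine (iInf₂_le_of_le x₀ (s₀ m₀) <| iInf₂_le_of_le x₁ (s₁ m₁) <| iInf_le _ hx).trans ?_
  rw [mul_add, mul_left_comm]
  gcongr
  · exact (b₀ x₀ m₀).trans (by gcongr; simp)
  · exact (b₁ x₁ m₁).trans (by gcongr; simp)

end KFunctional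

section Interpolation

variable {X : Type*} [Add X] {A₀ A₁ B₀ B₁ : QNSpace X} {θ : ℝ} {q r s : ℝ≥0∞} {a b c : ℝ → ℝ}

theorem Embeds.rrInterpolation (h₀ : A₀.Embeds B₀) (h₁ : A₁.Embeds B₁) :
    (rrInterpolation A₀ A₁ θ s c r b q a).Embeds (rrInterpolation B₀ B₁ θ s c r b q a) := by
  obtain ⟨C, hC⟩ := h₀.exists_K_le h₁
  have hle (x : X) := rrNorm_le_const_mul (γ := -θ) (q := q) (r := r) (s := s) (a := a) (b := b)
    (c := c) fun v _ => hC v x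
  refine ⟨?_, C, fun x _ => hle x⟩
  rintro x ⟨⟨x₀, m₀, x₁, m₁, hx⟩, hfin⟩
  exact ⟨⟨x₀, h₀.1 m₀, x₁, h₁.1 m₁, hx⟩,
    (hle x).trans_lt (ENNReal.mul_lt_top ENNReal.coe_lt_top hfin)⟩

theorem ofQNorm_embeds_rrInterpolation (hq : q ≠ 0) (hr : r ≠ 0) (hs : s ≠ 0)
    (ha : ∀ v, 0 < v → 0 < a v) (hb : ∀ v, 0 < v → 0 < b v) (hc : ∀ v, 0 < v → 0 < c v)
    {N : X → ℝ≥0∞} {C : ℝ≥0}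
    (h : ∀ x, rrNorm (-θ) s c r b q a (fun v => A₀.K A₁ v x) ≤ C * N x) :
    (ofQNorm N).Embeds (_root_.rrInterpolation A₀ A₁ θ s c r b q a) := by
  refine ⟨fun x hx => ?_, C, fun x _ => h x⟩
  have hfin := (h x).trans_lt (ENNReal.mul_lt_top ENNReal.coe_lt_top hx)
  obtain ⟨v, -, hv⟩ := exists_lt_top_of_rrNorm_lt_top hq hr hs ha hb hc hfin
  exact ⟨mem_sumSet_of_K_lt_top hv, hfin⟩

theorem rrInterpolation_embeds_ofQNorm {N : X → ℝ≥0∞} {C : ℝ≥0}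
    (h : ∀ x, N x ≤ C * rrNorm (-θ) s c r b q a (fun v => A₀.K A₁ v x)) :
    (_root_.rrInterpolation A₀ A₁ θ s c r b q a).Embeds (ofQNorm N) :=
  ⟨fun x hx => (h x).trans_lt (ENNReal.mul_lt_top ENNReal.coe_lt_top hx.2), C, fun x _ => h x⟩

end Interpolation

end QNSpace

section Rearrangement

variable {Ω : Type*} [MeasurableSpace Ω] {μ : Measure Ω} {𝕜 : Type*} [RCLike 𝕜] {κ t : ℝ}

theorem rearr_antitone (f : Ω →ₘ[μ] 𝕜) : Antitone (rearr f) := fun _ _ h =>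
  sInf_le_sInf fun _ hl => le_trans hl (ENNReal.ofReal_le_ofReal h)

theorem rearr_le_iff {f : Ω →ₘ[μ] 𝕜} {l : ℝ≥0∞} :
    rearr f t ≤ l ↔ μ {x | l < ‖f x‖ₑ} ≤ ENNReal.ofReal t := by
  refine ⟨fun h => ?_, fun h => sInf_le h⟩
  obtain ⟨u, hu, hlim, hmem⟩ := exists_seq_tendsto_sInf
    (S := {l : ℝ≥0∞ | μ {x | l < ‖f x‖ₑ} ≤ ENNReal.ofReal t}) ⟨∞, by simp⟩ (OrderBot.bddBelow _)
  have hunion : {x | l < ‖f x‖ₑ} ⊆ ⋃ n, {x | u n < ‖f x‖ₑ} := fun x hx =>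
    mem_iUnion.2 (hlim.eventually_lt_const (h.trans_lt hx)).exists
  have hmono : Monotone fun n => {x | u n < ‖f x‖ₑ} := fun m n hmn x hx => (hu hmn).trans_lt hx
  exact (measure_mono hunion).trans (hmono.measure_iUnion.trans_le (iSup_le hmem))

theorem rearr_add_le (f g : Ω →ₘ[μ] 𝕜) (t : ℝ) :
    rearr (f + g) t ≤ rearr f t + eLpNorm g ∞ μ := by
  refine rearr_le_iff.2 (le_trans (measure_mono_ae ?_) ((rearr_le_iff (f := f)).1 le_rfl))
  filter_upwards [AEEqFun.coeFn_add f g, enorm_ae_le_eLpNormEssSup g μ] with x hx hg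
    (hlt : _ < ‖(f + g) x‖ₑ)
  contrapose! hlt
  rw [hx, eLpNorm_exponent_top]
  exact (enorm_add_le _ _).trans (add_le_add (not_lt.1 hlt) hg)

theorem rpow_mul_rearr_le_eLpNorm (hκ : 0 < κ) (f : Ω →ₘ[μ] 𝕜) (ht : 0 < t) :
    ENNReal.ofReal (t ^ (1 / κ)) * rearr f t ≤ eLpNorm f (ENNReal.ofReal κ) μ := by
  have ht' : ENNReal.ofReal (t ^ (1 / κ)) ≠ 0 := by
    simpa using Real.rpow_pos_of_pos ht _
  rw [mul_comm, ← ENNReal.le_div_iff_mul_le (Or.inl ht') (Or.inl ENNReal.ofReal_ne_top)]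
  refine le_of_forall_lt_imp_le_of_dense fun l hl => ?_
  rw [ENNReal.le_div_iff_mul_le (Or.inl ht') (Or.inl ENNReal.ofReal_ne_top),
    ← ENNReal.rpow_le_rpow_iff hκ, ENNReal.mul_rpow_of_nonneg _ _ hκ.le,
    ENNReal.ofReal_rpow_of_nonneg (by positivity) hκ.le, ← Real.rpow_mul ht.le,
    one_div_mul_cancel hκ.ne', Real.rpow_one]
  have hlevel : ENNReal.ofReal t < μ {x | l < ‖f x‖ₑ} :=
    not_le.1 fun h => hl.not_ge (rearr_le_iff.2 h)
  have hcheb := mul_meas_ge_le_pow_eLpNorm' μ (p := ENNReal.ofReal κ) (by simpa using hκ)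
    ENNReal.ofReal_ne_top f.aestronglyMeasurable l
  rw [ENNReal.toReal_ofReal hκ.le] at hcheb
  refine le_trans ?_ hcheb
  gcongr
  exact hlevel.le.trans (measure_mono fun x (hx : l < ‖f x‖ₑ) => hx.le)

theorem recip_top : recip ∞ = 0 := by simp [recip]

theorem recip_ofReal (hκ : 0 < κ) : recip (ENNReal.ofReal κ) = 1 / κ := by
  rw [recip, ENNReal.toReal_inv, ENNReal.toReal_ofReal hκ.le, one_div]

theorem qnorm_lorentzSpace_top (hκ : 0 < κ) (f : Ω →ₘ[μ] 𝕜) :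
    (lorentzSpace μ 𝕜 (ENNReal.ofReal κ) ∞).qnorm f
      = essSup (fun u => ENNReal.ofReal (u ^ (1 / κ)) * rearr f u) (volume.restrict (Ioi 0)) := by
  simp [lorentzSpace, QNSpace.ofQNorm, wnorm, eLpNormEssSup, recip_top, recip_ofReal hκ]

theorem lebesgueSpace_embeds_lorentzSpace (hκ : 0 < κ) :
    (lebesgueSpace μ 𝕜 (ENNReal.ofReal κ)).Embeds (lorentzSpace μ 𝕜 (ENNReal.ofReal κ) ∞) := by
  have hle (f : Ω →ₘ[μ] 𝕜) : (lorentzSpace μ 𝕜 (ENNReal.ofReal κ) ∞).qnorm f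
      ≤ (lebesgueSpace μ 𝕜 (ENNReal.ofReal κ)).qnorm f := by
    rw [qnorm_lorentzSpace_top hκ]
    refine essSup_le_of_ae_le _ ?_
    filter_upwards [ae_restrict_mem measurableSet_Ioi] with t ht
    exact rpow_mul_rearr_le_eLpNorm hκ f ht
  exact ⟨fun f hf => (hle f).trans_lt hf, 1, fun f _ => by simpa using hle f⟩

theorem rpow_mul_rearr_le_lorentzSpace (hκ : 0 < κ) (f : Ω →ₘ[μ] 𝕜) (ht : 0 < t) :
    ENNReal.ofReal (t ^ (1 / κ)) * rearr f t
      ≤ (lorentzSpace μ 𝕜 (ENNReal.ofReal κ) ∞).qnorm f := by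
  -- The essential supremum bounds every value, since `rearr f` is antitone.
  set M := (lorentzSpace μ 𝕜 (ENNReal.ofReal κ) ∞).qnorm f with hM
  have hae : ∀ᵐ u : ℝ, 0 < u → ENNReal.ofReal (u ^ (1 / κ)) * rearr f u ≤ M := by
    rw [hM, qnorm_lorentzSpace_top hκ]
    exact (ae_restrict_iff' measurableSet_Ioi).1 (ENNReal.ae_le_essSup _)
  have hleft : ∀ v ∈ Ioo 0 t, ENNReal.ofReal (v ^ (1 / κ)) * rearr f t ≤ M := by
    rintro v ⟨hv₀, hvt⟩
    obtain ⟨u, hu, hvu, hut⟩ := (Measure.dense_of_ae hae).exists_between hvt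
    refine le_trans ?_ (hu (hv₀.trans hvu))
    gcongr
    exact rearr_antitone f hut.le
  have hlim : Filter.Tendsto (fun v : ℝ => ENNReal.ofReal (v ^ (1 / κ)) * rearr f t)
      (nhdsWithin t (Iio t)) (nhds (ENNReal.ofReal (t ^ (1 / κ)) * rearr f t)) := by
    refine ENNReal.Tendsto.mul_const (ENNReal.tendsto_ofReal ?_)
      (Or.inl (by simpa using Real.rpow_pos_of_pos ht _))
    exact (Real.continuousAt_rpow_const t _ (Or.inl ht.ne')).tendsto.mono_left nhdsWithin_le_nhds
  exact le_of_tendsto hlim (Filter.mem_of_superset (Ioo_mem_nhdsLT ht) hleft)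

end Rearrangement

section Truncation

variable {Ω : Type*} [MeasurableSpace Ω] {μ : Measure Ω} {𝕜 : Type*} [RCLike 𝕜] {κ : ℝ}

theorem measurableSet_lt_enorm (l : ℝ≥0∞) (f : Ω →ₘ[μ] 𝕜) : MeasurableSet {x | l < ‖f x‖ₑ} :=
  measurableSet_lt measurable_const f.stronglyMeasurable.measurable.enorm

/-- The part of `f` living where `|f|` exceeds the level `l`. -/
noncomputable def largePart (l : ℝ≥0∞) (f : Ω →ₘ[μ] 𝕜) : Ω →ₘ[μ] 𝕜 :=
  AEEqFun.mk ({x | l < ‖f x‖ₑ}.indicator f)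
    (f.stronglyMeasurable.indicator (measurableSet_lt_enorm l f)).aestronglyMeasurable

theorem coeFn_largePart (l : ℝ≥0∞) (f : Ω →ₘ[μ] 𝕜) :
    largePart l f =ᵐ[μ] {x | l < ‖f x‖ₑ}.indicator f :=
  AEEqFun.coeFn_mk _ _

theorem eLpNorm_sub_largePart_le (l : ℝ≥0∞) (f : Ω →ₘ[μ] 𝕜) :
    eLpNorm (f - largePart l f : Ω →ₘ[μ] 𝕜) ∞ μ ≤ l := by
  rw [eLpNorm_exponent_top]
  refine essSup_le_of_ae_le _ ?_
  filter_upwards [AEEqFun.coeFn_sub f (largePart l f), coeFn_largePart l f] with x hsub hx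
  rw [hsub, Pi.sub_apply, hx]
  by_cases h : l < ‖f x‖ₑ
  · simp [h]
  · simpa [h] using not_lt.1 h

theorem eLpNorm_largePart (hκ : 0 < κ) (l : ℝ≥0∞) (f : Ω →ₘ[μ] 𝕜) :
    eLpNorm (largePart l f) (ENNReal.ofReal κ) μ
      = (∫⁻ x in {x | l < ‖f x‖ₑ}, ‖f x‖ₑ ^ κ ∂μ) ^ (1 / κ) := by
  rw [eLpNorm_congr_ae (coeFn_largePart l f),
    eLpNorm_indicator_eq_eLpNorm_restrict (measurableSet_lt_enorm l f),
    eLpNorm_eq_lintegral_rpow_enorm_toReal (by simpa using hκ) ENNReal.ofReal_ne_top,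
    ENNReal.toReal_ofReal hκ.le]

theorem exists_lt_le_succ {u : ℕ → ℝ≥0∞} {y : ℝ≥0∞} (h₀ : u 0 < y) (h : ∃ n, y ≤ u n) :
    ∃ n, u n < y ∧ y ≤ u (n + 1) := by
  by_contra! hstep
  obtain ⟨n, hn⟩ := h
  exact hn.not_gt (n.rec h₀ hstep)

theorem ae_exists_le_rearr (f : Ω →ₘ[μ] 𝕜) {T : ℕ → ℝ}
    (hT : Filter.Tendsto T Filter.atTop (nhds 0)) : ∀ᵐ x ∂μ, ∃ n, ‖f x‖ₑ ≤ rearr f (T n) := by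
  have hnull : μ (⋂ n, {x | rearr f (T n) < ‖f x‖ₑ}) = 0 := by
    have hlim : Filter.Tendsto (fun n => ENNReal.ofReal (T n)) Filter.atTop (nhds 0) := by
      simpa using ENNReal.tendsto_ofReal hT
    exact nonpos_iff_eq_zero.1 <| ge_of_tendsto' hlim fun n =>
      (measure_mono (iInter_subset _ n)).trans (rearr_le_iff.1 le_rfl)
  filter_upwards [measure_eq_zero_iff_ae_notMem.1 hnull] with x hx
  simpa using hx

theorem setLIntegral_rearr_lt_enorm_le_tsum (hκ : 0 < κ) (f : Ω →ₘ[μ] 𝕜) {T : ℕ → ℝ}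
    (hT : Filter.Tendsto T Filter.atTop (nhds 0)) :
    ∫⁻ x in {x | rearr f (T 0) < ‖f x‖ₑ}, ‖f x‖ₑ ^ κ ∂μ
      ≤ ∑' k, ENNReal.ofReal (T k) * rearr f (T (k + 1)) ^ κ := by
  set E : ℕ → Set Ω := fun k => {x | rearr f (T k) < ‖f x‖ₑ}
  have hE (k : ℕ) : MeasurableSet (E k) := measurableSet_lt_enorm _ f
  have hlayers : ∀ᵐ x ∂μ, x ∈ E 0 →
      ‖f x‖ₑ ^ κ ≤ ∑' k, (E k).indicator (fun _ => rearr f (T (k + 1)) ^ κ) x := by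
    filter_upwards [ae_exists_le_rearr f hT] with x hx h₀
    obtain ⟨k, hk, hk'⟩ := exists_lt_le_succ h₀ hx
    refine le_trans ?_ (ENNReal.le_tsum k)
    rw [indicator_of_mem (show x ∈ E k from hk)]
    gcongr
  calc
    _ ≤ ∫⁻ x, ∑' k, (E k).indicator (fun _ => rearr f (T (k + 1)) ^ κ) x ∂μ :=
      (setLIntegral_mono_ae' (hE 0) hlayers).trans (setLIntegral_le_lintegral _ _)
    _ = ∑' k, μ (E k) * rearr f (T (k + 1)) ^ κ := by
      rw [lintegral_tsum fun k => (measurable_const.indicator (hE k)).aemeasurable]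
      simp only [lintegral_indicator_const (hE _), mul_comm]
    _ ≤ _ := by
      gcongr with k
      exact rearr_le_iff.1 le_rfl

end Truncation

section KFunctionalOfRearrangement

variable {Ω : Type*} [MeasurableSpace Ω] {μ : Measure Ω} {𝕜 : Type*} [RCLike 𝕜] {κ ρ t : ℝ}

/-- The function `t ↦ t f^*(t^κ)`, which controls the `K`-functional of `f` between an `L_κ`-type
space and `L_∞`: from below pointwise, from above through its dyadic sums. -/
noncomputable def scaledRearr (κ : ℝ) (f : Ω →ₘ[μ] 𝕜) (t : ℝ) : ℝ≥0∞ :=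
  ENNReal.ofReal t * rearr f (t ^ κ)

theorem measurable_scaledRearr (κ : ℝ) (f : Ω →ₘ[μ] 𝕜) : Measurable (scaledRearr κ f) :=
  ENNReal.measurable_ofReal.mul ((rearr_antitone f).measurable.comp (by fun_prop))

theorem scaledRearr_le_K_lorentzSpace (hκ : 0 < κ) (f : Ω →ₘ[μ] 𝕜) (ht : 0 < t) :
    scaledRearr κ f t
      ≤ (lorentzSpace μ 𝕜 (ENNReal.ofReal κ) ∞).K (lebesgueSpace μ 𝕜 ∞) t f := by
  refine le_iInf₂ fun f₀ _ => le_iInf₂ fun f₁ _ => le_iInf fun hf => ?_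
  have hroot : (t ^ κ) ^ (1 / κ) = t := by rw [one_div, Real.rpow_rpow_inv ht.le hκ.ne']
  calc
    scaledRearr κ f t ≤ ENNReal.ofReal t * (rearr f₀ (t ^ κ) + eLpNorm f₁ ∞ μ) := by
      rw [scaledRearr, hf]
      exact mul_le_mul_right (rearr_add_le f₀ f₁ _) _
    _ = ENNReal.ofReal ((t ^ κ) ^ (1 / κ)) * rearr f₀ (t ^ κ)
        + ENNReal.ofReal t * eLpNorm f₁ ∞ μ := by rw [mul_add, hroot]
    _ ≤ _ := add_le_add_left (rpow_mul_rearr_le_lorentzSpace hκ f₀ (by positivity)) _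

theorem eLpNorm_largePart_rearr_le (hκ : 0 < κ) (f : Ω →ₘ[μ] 𝕜) (ht : 0 < t) :
    eLpNorm (largePart (rearr f (t ^ κ)) f) (ENNReal.ofReal κ) μ
      ≤ 2 * dyadicSum κ (scaledRearr κ f) t := by
  have hlim : Filter.Tendsto (fun k : ℕ => (t / 2 ^ k) ^ κ) Filter.atTop (nhds 0) := by
    have h : Filter.Tendsto (fun k : ℕ => t / (2 : ℝ) ^ k) Filter.atTop (nhds 0) :=
      tendsto_const_nhds.div_atTop (tendsto_pow_atTop_atTop_of_one_lt one_lt_two)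
    simpa [Real.zero_rpow hκ.ne'] using h.rpow_const (Or.inr hκ.le)
  have hlayer (k : ℕ) : ENNReal.ofReal ((t / 2 ^ k) ^ κ) * rearr f ((t / 2 ^ (k + 1)) ^ κ) ^ κ
      = 2 ^ κ * scaledRearr κ f (t / 2 ^ (k + 1)) ^ κ := by
    have hhalf : t / 2 ^ k = 2 * (t / 2 ^ (k + 1)) := by rw [pow_succ]; field_simp
    rw [hhalf, ← ENNReal.ofReal_rpow_of_nonneg (by positivity) hκ.le,
      ENNReal.ofReal_mul zero_le_two, ENNReal.ofReal_ofNat, scaledRearr,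
      ← ENNReal.mul_rpow_of_nonneg _ _ hκ.le, ← ENNReal.mul_rpow_of_nonneg _ _ hκ.le, mul_assoc]
  have hint := setLIntegral_rearr_lt_enorm_le_tsum hκ f hlim
  simp only [pow_zero, div_one, hlayer, ENNReal.tsum_mul_left] at hint
  rw [eLpNorm_largePart hκ, one_div, ENNReal.rpow_inv_le_iff hκ,
    ENNReal.mul_rpow_of_nonneg _ _ hκ.le, dyadicSum, one_div, ENNReal.rpow_inv_rpow hκ.ne']
  refine hint.trans (mul_le_mul_right ?_ _)
  exact ENNReal.tsum_comp_le_tsum_of_injective (add_left_injective 1)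
    fun k : ℕ => scaledRearr κ f (t / 2 ^ k) ^ κ

theorem le_dyadicSum (hρ : 0 < ρ) (g : ℝ → ℝ≥0∞) (t : ℝ) : g t ≤ dyadicSum ρ g t := by
  rw [dyadicSum, one_div, ENNReal.le_rpow_inv_iff hρ]
  simpa using ENNReal.le_tsum (f := fun k : ℕ => g (t / 2 ^ k) ^ ρ) 0

theorem K_lebesgueSpace_le_dyadicSum (hρ : 0 < ρ) (hρκ : ρ ≤ κ) (f : Ω →ₘ[μ] 𝕜) (ht : 0 < t) :
    (lebesgueSpace μ 𝕜 (ENNReal.ofReal κ)).K (lebesgueSpace μ 𝕜 ∞) t f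
      ≤ (3 : ℝ≥0) * dyadicSum ρ (scaledRearr κ f) t := by
  have hκ : 0 < κ := hρ.trans_le hρκ
  set l := rearr f (t ^ κ)
  calc
    _ = (lebesgueSpace μ 𝕜 (ENNReal.ofReal κ)).K (lebesgueSpace μ 𝕜 ∞) t
        (largePart l f + (f - largePart l f)) := by rw [add_sub_cancel]
    _ ≤ eLpNorm (largePart l f) (ENNReal.ofReal κ) μ
        + ENNReal.ofReal t * eLpNorm (f - largePart l f : Ω →ₘ[μ] 𝕜) ∞ μ :=
      QNSpace.K_ofQNorm_add_le ht _ _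
    _ ≤ 2 * dyadicSum κ (scaledRearr κ f) t + scaledRearr κ f t :=
      add_le_add (eLpNorm_largePart_rearr_le hκ f ht)
        (mul_le_mul_right (eLpNorm_sub_largePart_le l f) _)
    _ ≤ 2 * dyadicSum κ (scaledRearr κ f) t + dyadicSum κ (scaledRearr κ f) t := by
      gcongr
      exact le_dyadicSum hκ _ t
    _ = (3 : ℝ≥0) * dyadicSum κ (scaledRearr κ f) t := by push_cast; ring
    _ ≤ _ := mul_le_mul_right (dyadicSum_antitone hρ hρκ _ t) _

end KFunctionalOfRearrangement

section Interpolation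

variable {Ω : Type*} [MeasurableSpace Ω] {μ : Measure Ω} {𝕜 : Type*} [RCLike 𝕜]
  {θ κ : ℝ} {q r s : ℝ≥0∞} {a b c : ℝ → ℝ}

theorem recip_ofReal_div (hκ : 0 < κ) (hθ : θ ≤ 1) :
    recip (ENNReal.ofReal κ / ENNReal.ofReal (1 - θ)) = (1 - θ) / κ := by
  rw [recip, ENNReal.inv_div (Or.inl ENNReal.ofReal_ne_top) (Or.inr (by simpa using hκ)),
    ENNReal.toReal_div, ENNReal.toReal_ofReal hκ.le, ENNReal.toReal_ofReal (by linarith)]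

theorem rrNorm_ofReal_mul_comp_rpow (hκ : 0 < κ) (hq : q ≠ 0) (hr : r ≠ 0) (hs : s ≠ 0)
    (F : ℝ → ℝ≥0∞) :
    rrNorm (-θ) s c r b q a (fun v => ENNReal.ofReal v * F (v ^ κ))
      = ENNReal.ofReal ((1 / κ) ^ (recip q + recip r + recip s)) *
        rrNorm ((1 - θ) / κ) s (dddot κ c) r (dddot κ b) q (dddot κ a) F := by
  have hweight := rrNorm_rpow_mul (s := s) (c := c) (r := r) (b := b) (q := q) (a := a) (-θ) 1
    fun v => F (v ^ κ)
  simp only [Real.rpow_one] at hweight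
  rw [hweight, rrNorm_comp_mul_rpow hq hr hs one_pos (one_div_pos.2 hκ)]
  simp only [Real.one_rpow, one_mul]
  refine congrArg _ (rrNorm_congr fun x hx => ?_)
  rw [one_div, Real.rpow_inv_rpow hx.le hκ.ne', ← div_eq_mul_inv, neg_add_eq_sub, dddot, one_div]

theorem exists_rrNorm_scaledRearr_eq (hκ : 0 < κ) (hθ : θ ≤ 1) (hq : q ≠ 0) (hr : r ≠ 0)
    (hs : s ≠ 0) :
    ∃ m : ℝ≥0, m ≠ 0 ∧ ∀ f : Ω →ₘ[μ] 𝕜, rrNorm (-θ) s c r b q a (scaledRearr κ f)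
      = m * (rrLorentzKaramata μ 𝕜 (ENNReal.ofReal κ / ENNReal.ofReal (1 - θ)) s (dddot κ c) r
        (dddot κ b) q (dddot κ a)).qnorm f := by
  refine ⟨((1 / κ) ^ (recip q + recip r + recip s)).toNNReal, ?_, fun f => ?_⟩
  · rw [Ne, Real.toNNReal_eq_zero, not_le]
    positivity
  · rw [rrLorentzKaramata, QNSpace.ofQNorm, recip_ofReal_div hκ hθ]
    exact rrNorm_ofReal_mul_comp_rpow hκ hq hr hs (rearr f)

theorem rrInterpolation_lorentzSpace_embeds_rrLorentzKaramata (hκ : 0 < κ) (hθ : θ ≤ 1)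
    (hq : q ≠ 0) (hr : r ≠ 0) (hs : s ≠ 0) :
    (rrInterpolation (lorentzSpace μ 𝕜 (ENNReal.ofReal κ) ∞) (lebesgueSpace μ 𝕜 ∞)
      θ s c r b q a).Embeds
    (rrLorentzKaramata μ 𝕜 (ENNReal.ofReal κ / ENNReal.ofReal (1 - θ)) s (dddot κ c) r
      (dddot κ b) q (dddot κ a)) := by
  obtain ⟨m, hm, hnorm⟩ := exists_rrNorm_scaledRearr_eq (μ := μ) (𝕜 := 𝕜) (a := a) (b := b)
    (c := c) hκ hθ hq hr hs
  refine QNSpace.rrInterpolation_embeds_ofQNorm (C := m⁻¹) fun f => ?_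
  rw [ENNReal.coe_inv hm, ← ENNReal.mul_le_iff_le_inv (by simpa using hm) ENNReal.coe_ne_top]
  refine (hnorm f).symm.trans_le ?_
  simpa using rrNorm_le_const_mul (A := 1) (γ := -θ) (q := q) (r := r) (s := s) (a := a)
    (b := b) (c := c) fun v hv =>
      (scaledRearr_le_K_lorentzSpace hκ f hv).trans_eq (one_mul _).symm

theorem exists_pos_ofReal_le {d : ℝ≥0∞} (hd : d ≠ 0) : ∃ ρ : ℝ, 0 < ρ ∧ ENNReal.ofReal ρ ≤ d := by
  obtain ⟨ρ, hρ, h⟩ := ENNReal.lt_iff_exists_nnreal_btwn.1 (pos_iff_ne_zero.2 hd)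
  exact ⟨ρ, by exact_mod_cast hρ, by simpa using h.le⟩

theorem rrLorentzKaramata_embeds_rrInterpolation_lebesgueSpace {α β δ : ℝ} (hκ : 0 < κ)
    (hθ : θ ≤ 1) (hq : q ≠ 0) (hr : r ≠ 0) (hs : s ≠ 0) (ha : UpperType α a)
    (hb : UpperType β b) (hc : UpperType δ c) (hαβδ : α + β + δ < θ) :
    (rrLorentzKaramata μ 𝕜 (ENNReal.ofReal κ / ENNReal.ofReal (1 - θ)) s (dddot κ c) r
      (dddot κ b) q (dddot κ a)).Embeds
    (rrInterpolation (lebesgueSpace μ 𝕜 (ENNReal.ofReal κ)) (lebesgueSpace μ 𝕜 ∞)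
      θ s c r b q a) := by
  obtain ⟨ρ, hρ, hle⟩ : ∃ ρ : ℝ, 0 < ρ ∧
      ENNReal.ofReal ρ ≤ min (min q r) (min s (ENNReal.ofReal κ)) :=
    exists_pos_ofReal_le (by simp [← pos_iff_ne_zero, pos_iff_ne_zero.2 hq,
      pos_iff_ne_zero.2 hr, pos_iff_ne_zero.2 hs, hκ])
  simp only [le_inf_iff, ENNReal.ofReal_le_ofReal_iff hκ.le] at hle
  obtain ⟨⟨hρq, hρr⟩, hρs, hρκ⟩ := hle
  obtain ⟨C, hC⟩ := rrNorm_dyadicSum_le (γ := -θ) ha hb hc (by linarith) hρ hρq hρr hρs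
  obtain ⟨m, -, hnorm⟩ := exists_rrNorm_scaledRearr_eq (μ := μ) (𝕜 := 𝕜) (a := a) (b := b)
    (c := c) hκ hθ hq hr hs
  refine QNSpace.ofQNorm_embeds_rrInterpolation hq hr hs ha.pos hb.pos hc.pos
    (C := 3 * (C * m)) fun f => ?_
  calc
    _ ≤ (3 : ℝ≥0) * rrNorm (-θ) s c r b q a (dyadicSum ρ (scaledRearr κ f)) :=
      rrNorm_le_const_mul fun v hv => K_lebesgueSpace_le_dyadicSum hρ hρκ f hv
    _ ≤ (3 : ℝ≥0) * (C * rrNorm (-θ) s c r b q a (scaledRearr κ f)) :=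
      mul_le_mul_right (hC _ (measurable_scaledRearr κ f)) _
    _ = _ := by
      rw [hnorm, ENNReal.coe_mul, ENNReal.coe_mul, mul_assoc, mul_assoc]
      rfl

end Interpolation

theorem theorem5p5_general {Ω : Type*} [MeasurableSpace Ω] (μ : Measure Ω) (𝕜 : Type*) [RCLike 𝕜]
    {θ κ : ℝ} (hθ : θ ≤ 1) (hκ : 0 < κ)
    {p : ℝ≥0∞} (hp : p = ENNReal.ofReal κ / ENNReal.ofReal (1 - θ))
    {q s r : ℝ≥0∞} (hq : 0 < q) (hs : 0 < s) (hr : 0 < r) {a b c : ℝ → ℝ} {α β δ : ℝ}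
    (ha : UpperType α a) (hb : UpperType β b) (hc : UpperType δ c) (hαβδ : α + β + δ < θ) :
    QNSpace.Identical
      (rrInterpolation (lebesgueSpace μ 𝕜 (ENNReal.ofReal κ)) (lebesgueSpace μ 𝕜 ∞) θ s c r b q a)
      (rrInterpolation (lorentzSpace μ 𝕜 (ENNReal.ofReal κ) ∞) (lebesgueSpace μ 𝕜 ∞) θ s c r b q a)
    ∧ QNSpace.Identical
      (rrInterpolation (lorentzSpace μ 𝕜 (ENNReal.ofReal κ) ∞) (lebesgueSpace μ 𝕜 ∞) θ s c r b q a)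
      (rrLorentzKaramata μ 𝕜 p s (dddot κ c) r (dddot κ b) q (dddot κ a))
    ∧ QNSpace.Identical
      (rrInterpolation (lebesgueSpace μ 𝕜 (ENNReal.ofReal κ)) (lebesgueSpace μ 𝕜 ∞) θ s c r b q a)
      (rrLorentzKaramata μ 𝕜 p s (dddot κ c) r (dddot κ b) q (dddot κ a)) := by
  subst hp
  have strong_weak := (lebesgueSpace_embeds_lorentzSpace (μ := μ) (𝕜 := 𝕜) hκ).rrInterpolation
    (.refl (lebesgueSpace μ 𝕜 ∞)) (θ := θ) (q := q) (r := r) (s := s) (a := a) (b := b) (c := c)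
  have weak_karamata := rrInterpolation_lorentzSpace_embeds_rrLorentzKaramata (μ := μ) (𝕜 := 𝕜)
    (a := a) (b := b) (c := c) hκ hθ hq.ne' hr.ne' hs.ne'
  have karamata_strong := rrLorentzKaramata_embeds_rrInterpolation_lebesgueSpace (μ := μ) (𝕜 := 𝕜)
    hκ hθ hq.ne' hr.ne' hs.ne' ha hb hc hαβδ
  exact ⟨⟨strong_weak, weak_karamata.trans karamata_strong⟩,
    ⟨weak_karamata, karamata_strong.trans strong_weak⟩,
    ⟨strong_weak.trans weak_karamata, karamata_strong⟩⟩

theorem theorem5p5 {Ω : Type*} [MeasurableSpace Ω] (μ : Measure Ω) [SigmaFinite μ]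
    (hμ : NonAtomic μ) (𝕜 : Type*) [RCLike 𝕜]
    (θ κ : ℝ) (hθ₀ : 0 < θ) (hθ₁ : θ ≤ 1) (hκ : 0 < κ)
    (p : ℝ≥0∞) (hp : p = ENNReal.ofReal κ / ENNReal.ofReal (1 - θ))
    (q s r : ℝ≥0∞) (hq : 0 < q) (hs : 0 < s) (hr : 0 < r)
    (a b c : ℝ → ℝ) (ha : SlowlyVarying a) (hb : SlowlyVarying b) (hc : SlowlyVarying c) :
    QNSpace.Identical
      (rrInterpolation (lebesgueSpace μ 𝕜 (ENNReal.ofReal κ)) (lebesgueSpace μ 𝕜 ∞) θ s c r b q a)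
      (rrInterpolation (lorentzSpace μ 𝕜 (ENNReal.ofReal κ) ∞) (lebesgueSpace μ 𝕜 ∞) θ s c r b q a)
    ∧ QNSpace.Identical
      (rrInterpolation (lorentzSpace μ 𝕜 (ENNReal.ofReal κ) ∞) (lebesgueSpace μ 𝕜 ∞) θ s c r b q a)
      (rrLorentzKaramata μ 𝕜 p s (dddot κ c) r (dddot κ b) q (dddot κ a))
    ∧ QNSpace.Identical
      (rrInterpolation (lebesgueSpace μ 𝕜 (ENNReal.ofReal κ)) (lebesgueSpace μ 𝕜 ∞) θ s c r b q a)
      (rrLorentzKaramata μ 𝕜 p s (dddot κ c) r (dddot κ b) q (dddot κ a)) := by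
  exact theorem5p5_general μ 𝕜 hθ₁ hκ hp hq hs hr (ha.upperType (by positivity : 0 < θ / 4))
    (hb.upperType (by positivity : 0 < θ / 4)) (hc.upperType (by positivity : 0 < θ / 4))
    (by linarith)
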